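/- Let $d\ge 1$ and $q\ge 1$ be integers, let $\mu\ge 0$, and let $\Omega\subset\mathbb R^d$ be an open set of finite Lebesgue measure $|\Omega|$. On $L^2(\mathbb R^d,\mathbb C^q)$ let $\Pi^-:=\mathbf 1(-\Delta\le\mu)$ be the spectral projection of the Laplacian and $\Pi^+:=1-\Pi^-$. Put $$\rho_0:=q(2\pi)^{-d}\int_{|p|^2<\mu}dp,\qquad K_{\rm sc}(d):=\frac{d}{d+2}\left(\frac{d(2\pi)^d}{q\,|S^{d-1}|}\right)^{2/d}.$$ Let $\gamma$ be a bounded operator on $L^2(\mathbb R^d,\mathbb C^q)$ with $0\le\gamma\le \mathbf 1_{\mathbb R^d\setminus\Omega}$ (as operators, the right-hand side being multiplication by the indicator function), let $Q:=\gamma-\Pi^-$, $Q^{++}:=\Pi^+Q\Pi^+$, $Q^{--}:=\Pi^-Q\Pi^-$, and assume that the two operators $|-\Delta-\mu|^{1/2}Q^{\pm\pm}|-\Delta-\mu|^{1/2}$, understood in the sense of quadratic forms on the domain of $|-\Delta-\mu|^{1/2}$, are trace class. Define $$\mathrm{tr}_0(-\Delta-\mu)Q:=\mathrm{tr}\,|-\Delta-\mu|^{1/2}\,(Q^{++}-Q^{--})\,|-\Delta-\mu|^{1/2}.$$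 Then $$\mathrm{tr}_0(-\Delta-\mu)Q\ \ge\ \frac2d\,K_{\rm sc}(d)\,\rho_0^{1+2/d}\,|\Omega|.$$ -/

import Mathlib

open MeasureTheory FourierTransform
open scoped ENNReal InnerProductSpace

noncomputable section

namespace FermiSea

/-! ### Trace-class operators on a complex Hilbert space -/

section TraceClass

variable {H : Type*} [NormedAddCommGroup H] [InnerProductSpace ℂ H]

/-- `T` is the bounded operator `A B A`, in the sense of quadratic forms, where `A` is a
(possibly unbounded, symmetric) operator and `B` is bounded:
`⟪f, T g⟫ = ⟪A f, B A g⟫` for all `f, g` in the domain of `A`. -/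
def IsSandwich (A : H →ₗ.[ℂ] H) (B T : H →L[ℂ] H) : Prop :=
  ∀ f g : A.domain, ⟪(f : H), T (g : H)⟫_ℂ = ⟪A f, B (A g)⟫_ℂ

/-- If `A` is densely defined there is at most one bounded operator `A B A`. -/
theorem IsSandwich.unique {A : H →ₗ.[ℂ] H} (hA : Dense (A.domain : Set H)) {B T T' : H →L[ℂ] H}
    (h : IsSandwich A B T) (h' : IsSandwich A B T') : T = T' := by
  have key : ∀ g : A.domain, T g = T' g := fun g =>
    hA.eq_of_inner_right (𝕜 := ℂ) fun f hf => by
      rw [h ⟨f, hf⟩ g, h' ⟨f, hf⟩ g]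
  exact ContinuousLinearMap.coeFn_injective
    (Continuous.ext_on hA T.continuous T'.continuous fun g hg => key ⟨g, hg⟩)

variable [CompleteSpace H]

variable (H) in
/-- Index set of some orthonormal (Hilbert) basis of `H`. -/
def basisIndex : Set H := (exists_hilbertBasis ℂ H).choose

variable (H) in
/-- Some orthonormal (Hilbert) basis of `H`, used to compute traces. -/
def basis : HilbertBasis (basisIndex H) ℂ H := (exists_hilbertBasis ℂ H).choose_spec.choose

/-- A bounded operator `T` is trace class if `tr |T| = ∑ᵢ ⟪bᵢ, |T| bᵢ⟫ < ∞`, where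
`|T| = (T* T)^{1/2}`. Since `|T| ≥ 0`, the choice of the orthonormal basis is immaterial. -/
def IsTraceClass (T : H →L[ℂ] H) : Prop :=
  Summable fun i => (⟪basis H i, CFC.abs T (basis H i)⟫_ℂ).re

/-- The trace `tr T = ∑ᵢ ⟪bᵢ, T bᵢ⟫` of a trace-class operator, for which the series converges
absolutely and does not depend on the orthonormal basis. -/
def trace (T : H →L[ℂ] H) : ℂ := ∑' i, ⟪basis H i, T (basis H i)⟫_ℂ

open Classical in
/-- The bounded operator `A B A`, with the value `0` if the form `⟪A f, B A g⟫` is not that of a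
bounded operator. -/
def sandwich (A : H →ₗ.[ℂ] H) (B : H →L[ℂ] H) : H →L[ℂ] H :=
  if h : ∃ T, IsSandwich A B T then h.choose else 0

/-- `A B A` is (extends to) a trace-class operator. -/
def SandwichIsTraceClass (A : H →ₗ.[ℂ] H) (B : H →L[ℂ] H) : Prop :=
  ∃ T, IsSandwich A B T ∧ IsTraceClass T

end TraceClass

/-! ### The Hilbert space `L²(ℝᵈ, ℂ^q)`, cut-offs and Fourier multipliers -/

section Multiplication

variable {X V : Type*} [MeasureSpace X] [NormedAddCommGroup V] [InnerProductSpace ℂ V]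

/-- Multiplication by the indicator function of a measurable set `S`, as a linear map on
`L²(X, V)`. -/
def mulIndicatorₗ (S : Set X) (hS : MeasurableSet S) :
    Lp V 2 (volume : Measure X) →ₗ[ℂ] Lp V 2 (volume : Measure X) where
  toFun f := MemLp.toLp (S.indicator f) ((Lp.memLp f).indicator hS)
  map_add' f g := by
    rw [← MemLp.toLp_add]
    refine MemLp.toLp_congr _ _ ?_
    filter_upwards [Lp.coeFn_add f g] with x hx
    by_cases h : x ∈ S
    · simp only [Set.indicator_of_mem h, Pi.add_apply, hx]
    · simp only [Set.indicator_of_notMem h, Pi.add_apply, add_zero]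
  map_smul' c f := by
    rw [RingHom.id_apply, ← MemLp.toLp_const_smul]
    refine MemLp.toLp_congr _ _ ?_
    filter_upwards [Lp.coeFn_smul c f] with x hx
    by_cases h : x ∈ S
    · simp only [Set.indicator_of_mem h, Pi.smul_apply, hx]
    · simp only [Set.indicator_of_notMem h, Pi.smul_apply, smul_zero]

theorem coeFn_mulIndicatorₗ (S : Set X) (hS : MeasurableSet S)
    (f : Lp V 2 (volume : Measure X)) : mulIndicatorₗ S hS f =ᵐ[volume] S.indicator f := by
  have h : mulIndicatorₗ S hS f = MemLp.toLp (S.indicator f) ((Lp.memLp f).indicator hS) := rfl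
  rw [h]
  exact MemLp.coeFn_toLp _

theorem norm_mulIndicatorₗ_le (S : Set X) (hS : MeasurableSet S)
    (f : Lp V 2 (volume : Measure X)) : ‖mulIndicatorₗ S hS f‖ ≤ 1 * ‖f‖ := by
  rw [one_mul]
  refine Lp.norm_le_norm_of_ae_le ?_
  filter_upwards [coeFn_mulIndicatorₗ S hS f] with x hx
  rw [hx]
  exact norm_indicator_le_norm_self _ _

/-- Multiplication by the indicator function of a measurable set `S`, as a bounded operator on
`L²(X, V)`. -/
def mulIndicator (S : Set X) (hS : MeasurableSet S) :
    Lp V 2 (volume : Measure X) →L[ℂ] Lp V 2 (volume : Measure X) :=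
  (mulIndicatorₗ S hS).mkContinuous 1 (norm_mulIndicatorₗ_le S hS)

theorem coeFn_mulIndicator (S : Set X) (hS : MeasurableSet S)
    (f : Lp V 2 (volume : Measure X)) : mulIndicator S hS f =ᵐ[volume] S.indicator f :=
  coeFn_mulIndicatorₗ S hS f

/-- Multiplication by the real function `m` on `L²(X, V)`, with its maximal domain
`{f : m f ∈ L²}`. -/
def mulOperator (m : X → ℝ) : Lp V 2 (volume : Measure X) →ₗ.[ℂ] Lp V 2 (volume : Measure X) where
  domain :=
    { carrier := {f | MemLp (fun ξ => (m ξ : ℂ) • f ξ) 2 volume}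
      add_mem' := fun {f g} hf hg => by
        refine (memLp_congr_ae ?_).1 (MemLp.add hf hg)
        filter_upwards [Lp.coeFn_add f g] with x hx
        simp only [hx, Pi.add_apply, smul_add]
      zero_mem' := by
        refine (memLp_congr_ae ?_).1 (MemLp.zero' (ε := V))
        filter_upwards [Lp.coeFn_zero (V) 2
          (volume : Measure (X))] with x hx
        simp only [hx, Pi.zero_apply, smul_zero]
      smul_mem' := fun c f hf => by
        refine (memLp_congr_ae ?_).1 (MemLp.const_smul hf c)
        filter_upwards [Lp.coeFn_smul c f] with x hx
        simp only [hx, Pi.smul_apply, smul_comm c] }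
  toFun :=
    { toFun := fun f => MemLp.toLp (fun ξ => (m ξ : ℂ) • (f : Lp V 2 (volume : Measure X)) ξ) f.2
      map_add' := fun f g => by
        rw [← MemLp.toLp_add]
        refine MemLp.toLp_congr _ _ ?_
        filter_upwards [Lp.coeFn_add (f : Lp V 2 (volume : Measure X)) (g : Lp V 2 (volume : Measure X))] with x hx
        simp only [Submodule.coe_add, hx, Pi.add_apply, smul_add]
      map_smul' := fun c f => by
        rw [RingHom.id_apply, ← MemLp.toLp_const_smul]
        refine MemLp.toLp_congr _ _ ?_
        filter_upwards [Lp.coeFn_smul c (f : Lp V 2 (volume : Measure X))] with x hx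
        simp only [Submodule.coe_smul, hx, Pi.smul_apply, smul_comm c] }

end Multiplication

/-- Euclidean space `ℝᵈ`. -/
abbrev Space (d : ℕ) : Type := EuclideanSpace ℝ (Fin d)

/-- The one-particle space `L²(ℝᵈ, ℂ^q)`. -/
abbrev L2 (d q : ℕ) : Type :=
  Lp (α := Space d) (EuclideanSpace ℂ (Fin q)) 2 (volume : Measure (Space d))

variable {d q : ℕ}

/-- The Fourier transform `𝓕f(ξ) = ∫ e^{-2πi x·ξ} f(x) dx` as a unitary of `L²(ℝᵈ, ℂ^q)`. -/
abbrev fourierL2 (d q : ℕ) : L2 d q ≃ₗᵢ[ℂ] L2 d q :=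
  Lp.fourierTransformₗᵢ (Space d) (EuclideanSpace ℂ (Fin q))

/-- The self-adjoint operator `𝓕⁻¹ m 𝓕` on `L²(ℝᵈ, ℂ^q)`, for a real function `m`, with its
maximal domain `{f : m 𝓕f ∈ L²}`. -/
def fourierMultiplier (q : ℕ) (m : Space d → ℝ) : L2 d q →ₗ.[ℂ] L2 d q where
  domain := (mulOperator m : L2 d q →ₗ.[ℂ] L2 d q).domain.comap (fourierL2 d q).toLinearMap
  toFun := (fourierL2 d q).symm.toLinearMap ∘ₗ (mulOperator m).toFun ∘ₗ
    (fourierL2 d q).toLinearMap.restrict fun _ hf => hf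

/-! ### The free Fermi gas with chemical potential `μ` -/

/-- The symbol of `-Δ - μ`: in the above normalization of the Fourier transform, the operator `-Δ` is multiplication by `|2πξ|²`. -/
def symbol (d : ℕ) (μ : ℝ) (ξ : Space d) : ℝ := (2 * Real.pi * ‖ξ‖) ^ 2 - μ

theorem continuous_symbol (μ : ℝ) : Continuous (symbol d μ) := by
  unfold symbol; fun_prop

/-- The self-adjoint operator `|-Δ - μ|^{1/2}` on `L²(ℝᵈ, ℂ^q)`. -/
def sqrtAbs (d q : ℕ) (μ : ℝ) : L2 d q →ₗ.[ℂ] L2 d q :=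
  fourierMultiplier q fun ξ => Real.sqrt |symbol d μ ξ|

/-- The free Fermi sea `Π⁻ = 𝟙(-Δ ≤ μ)`. -/
def projMinus (d q : ℕ) (μ : ℝ) : L2 d q →L[ℂ] L2 d q :=
  ((fourierL2 d q).symm : L2 d q →L[ℂ] L2 d q) ∘L
    mulIndicator {ξ | symbol d μ ξ ≤ 0}
      (isClosed_le (continuous_symbol μ) continuous_const).measurableSet ∘L
    (fourierL2 d q : L2 d q →L[ℂ] L2 d q)

/-- `Π⁺ = 1 - Π⁻`. -/
def projPlus (d q : ℕ) (μ : ℝ) : L2 d q →L[ℂ] L2 d q := 1 - projMinus d q μ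

/-- `Q⁺⁺ = Π⁺ Q Π⁺`. -/
def blockPlus (μ : ℝ) (Q : L2 d q →L[ℂ] L2 d q) : L2 d q →L[ℂ] L2 d q :=
  projPlus d q μ ∘L Q ∘L projPlus d q μ

/-- `Q⁻⁻ = Π⁻ Q Π⁻`. -/
def blockMinus (μ : ℝ) (Q : L2 d q →L[ℂ] L2 d q) : L2 d q →L[ℂ] L2 d q :=
  projMinus d q μ ∘L Q ∘L projMinus d q μ

/-- Both `|-Δ-μ|^{1/2} Q^{±±} |-Δ-μ|^{1/2}` are trace class. -/
def HasFiniteRelativeEnergy (μ : ℝ) (Q : L2 d q →L[ℂ] L2 d q) : Prop :=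
  SandwichIsTraceClass (sqrtAbs d q μ) (blockPlus μ Q) ∧
    SandwichIsTraceClass (sqrtAbs d q μ) (blockMinus μ Q)

/-- The relative kinetic energy
`tr₀(-Δ-μ)Q = tr |-Δ-μ|^{1/2} (Q⁺⁺ - Q⁻⁻) |-Δ-μ|^{1/2}` of a bounded self-adjoint `Q` with
`HasFiniteRelativeEnergy μ Q`. The operator under the trace is self-adjoint, so its trace is
real. -/
def relativeEnergy (μ : ℝ) (Q : L2 d q →L[ℂ] L2 d q) : ℝ :=
  (trace (sandwich (sqrtAbs d q μ) (blockPlus μ Q - blockMinus μ Q))).re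

/-- The density `ρ₀ = q (2π)^{-d} ∫_{|p|² < μ} dp` of the free Fermi gas. -/
def fermiDensity (d q : ℕ) (μ : ℝ) : ℝ :=
  q * ((2 * Real.pi) ^ d)⁻¹ * (volume : Measure (Space d)).real {p | ‖p‖ ^ 2 < μ}

/-- The surface measure `|S^{d-1}|` of the unit sphere of `ℝᵈ`. -/
def sphereArea (d : ℕ) : ℝ := (volume : Measure (Space d)).toSphere.real Set.univ

/-- The semiclassical constant
`K_sc(d) = d / (d + 2) * (d (2π)^d / (q |S^{d-1}|))^{2/d}`. -/
def Ksc (d q : ℕ) : ℝ :=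
  (d : ℝ) / (d + 2) * (d * (2 * Real.pi) ^ d / (q * sphereArea d)) ^ ((2 : ℝ) / d)

theorem mem_domain_sqrtAbs (μ : ℝ) (n : ℕ) (g : L2 d q) :
    (fourierL2 d q).symm (mulIndicator (Metric.closedBall 0 n) measurableSet_closedBall g) ∈
      (sqrtAbs d q μ).domain := by
  change MemLp (fun ξ => ((Real.sqrt |symbol d μ ξ| : ℝ) : ℂ) • (fourierL2 d q
    ((fourierL2 d q).symm (mulIndicator (Metric.closedBall 0 n) measurableSet_closedBall g))) ξ)
    2 volume
  rw [LinearIsometryEquiv.apply_symm_apply]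
  have hc : Continuous fun ξ : Space d => Real.sqrt |symbol d μ ξ| :=
    Real.continuous_sqrt.comp (continuous_symbol μ).abs
  obtain ⟨C, hC⟩ := (isCompact_closedBall (0 : Space d) (n : ℝ)).exists_bound_of_continuousOn
    hc.continuousOn
  refine MemLp.of_le_mul (c := C) (Lp.memLp g) ?_ ?_
  · exact (Complex.continuous_ofReal.comp hc).aestronglyMeasurable.smul
      (Lp.aestronglyMeasurable _)
  · filter_upwards [coeFn_mulIndicator (Metric.closedBall 0 (n : ℝ)) measurableSet_closedBall g]
      with x hx
    rw [hx]
    by_cases h : x ∈ Metric.closedBall (0 : Space d) (n : ℝ)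
    · rw [Set.indicator_of_mem h, norm_smul, Complex.norm_real]
      exact mul_le_mul_of_nonneg_right (hC x h) (norm_nonneg _)
    · rw [Set.indicator_of_notMem h, smul_zero, norm_zero]
      exact mul_nonneg ((norm_nonneg _).trans (hC 0 (by simp))) (norm_nonneg _)

/-- The domain of `|-Δ - μ|^{1/2}` is dense, so that the operators sandwiched by it are unique. -/
theorem dense_domain_sqrtAbs (μ : ℝ) : Dense ((sqrtAbs d q μ).domain : Set (L2 d q)) := by
  rw [Submodule.dense_iff_topologicalClosure_eq_top,
    Submodule.topologicalClosure_eq_top_iff, Submodule.eq_bot_iff]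
  intro h hh
  have key : ∀ n : ℕ, ∀ᵐ ξ : Space d, ξ ∈ Metric.closedBall (0 : Space d) (n : ℝ) →
      (fourierL2 d q h) ξ = 0 := by
    intro n
    set P := mulIndicator (V := EuclideanSpace ℂ (Fin q)) (Metric.closedBall (0 : Space d) (n : ℝ))
      measurableSet_closedBall
    have h0 : ⟪P (fourierL2 d q h), fourierL2 d q h⟫_ℂ = 0 := by
      have := hh _ (mem_domain_sqrtAbs μ n (fourierL2 d q h))
      rwa [← (fourierL2 d q).inner_map_map, LinearIsometryEquiv.apply_symm_apply] at this
    have h1 : ⟪P (fourierL2 d q h), P (fourierL2 d q h)⟫_ℂ = 0 := by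
      rw [← h0, L2.inner_def, L2.inner_def]
      refine integral_congr_ae ?_
      filter_upwards [coeFn_mulIndicator (Metric.closedBall 0 (n : ℝ)) measurableSet_closedBall
        (fourierL2 d q h)] with x hx
      rw [hx]
      by_cases hb : x ∈ Metric.closedBall (0 : Space d) (n : ℝ)
      · rw [Set.indicator_of_mem hb]
      · rw [Set.indicator_of_notMem hb, inner_zero_left, inner_zero_left]
    have h2 : P (fourierL2 d q h) = 0 := inner_self_eq_zero.1 h1
    filter_upwards [coeFn_mulIndicator (Metric.closedBall 0 (n : ℝ)) measurableSet_closedBall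
      (fourierL2 d q h), Lp.coeFn_zero (EuclideanSpace ℂ (Fin q)) 2
          (volume : Measure (Space d))] with x hx hz hb
    rw [← Set.indicator_of_mem hb (fourierL2 d q h), ← hx]
    change (P (fourierL2 d q h)) x = 0
    rw [h2, hz]; rfl
  have h3 : fourierL2 d q h = 0 := by
    refine Lp.ext ?_
    filter_upwards [ae_all_iff.2 key, Lp.coeFn_zero (EuclideanSpace ℂ (Fin q)) 2
          (volume : Measure (Space d))] with x hx hz
    obtain ⟨n, hn⟩ := exists_nat_ge ‖x‖
    rw [hx n (by simpa using hn), hz]; rfl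
  exact (fourierL2 d q).map_eq_zero_iff.1 h3

end FermiSea

end

/-!
Write `A = |-Δ - μ|^{1/2}` and `Q = γ - Π⁻`. Since `Π⁺ Π⁻ = 0`, the block `Q⁺⁺ = Π⁺ γ Π⁺` is
nonnegative, and so is its contribution `tr A Q⁺⁺ A` to the relative energy, which is dropped.
On the other block, `A Π⁻` is the *bounded* operator `M = (-Δ - μ)₋^{1/2}` (`sqrtNegOp`), so that
`-A Q⁻⁻ A = M* (1 - γ) M` (`isSandwich_blockMinus`), and `1 - γ ≥ 𝟙_Ω` by assumption. Hence

  `tr₀(-Δ - μ)Q ≥ tr M* 𝟙_Ω M = ‖𝟙_Ω M‖²_HS`,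

as in the Berezin–Li–Yau argument. In the position representation `M` has the integral kernel
`∫ e^{2πi (x-y)·ξ} (symbol ξ)₋^{1/2} dξ`, and by Plancherel the Hilbert–Schmidt norm squared is
exactly `q |Ω| ∫ (symbol ξ)₋ dξ` (`tsum_norm_mulIndicator_sqrtNegOp_sq`). In polar coordinates
this integral gives `(2/d) K_sc(d) ρ₀^{1+2/d} |Ω|`, with equality (`semiclassical_eq`).

The operators `A Q⁺⁺ A` and `-A Q⁻⁻ A` are both nonnegative, hence equal to their absolute
values, so the trace-class assumption makes the diagonal sums converge and the series defining
the trace may be split and compared term by term.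
-/

noncomputable section

namespace FermiSea

/-! ### Operators on a Hilbert space -/

section Hilbert

variable {H : Type*} [NormedAddCommGroup H] [InnerProductSpace ℂ H]

theorem IsSandwich.sub {A : H →ₗ.[ℂ] H} {B B' T T' : H →L[ℂ] H}
    (h : IsSandwich A B T) (h' : IsSandwich A B' T') : IsSandwich A (B - B') (T - T') := by
  intro f g
  simp only [sub_apply, inner_sub_right, h f g, h' f g]

open scoped ComplexOrder in
theorem IsSandwich.nonneg {A : H →ₗ.[ℂ] H} (hA : Dense (A.domain : Set H))
    {B T : H →L[ℂ] H} (h : IsSandwich A B T) (hB : 0 ≤ B) : 0 ≤ T := by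
  rw [ContinuousLinearMap.nonneg_iff_isPositive] at hB ⊢
  have key : ∀ f : H, 0 ≤ ⟪f, T f⟫_ℂ := by
    have hc : IsClosed {f : H | 0 ≤ ⟪f, T f⟫_ℂ} :=
      isClosed_le continuous_const (by fun_prop)
    refine fun f => hc.closure_subset_iff.2 (fun g hg => ?_) (hA f)
    rw [Set.mem_ofPred_eq, h ⟨g, hg⟩ ⟨g, hg⟩]
    exact hB.inner_nonneg_right _
  rw [ContinuousLinearMap.isPositive_iff_complex]
  intro f
  have hf := key f
  rw [← inner_conj_symm, Complex.le_def, Complex.conj_re, Complex.conj_im] at hf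
  refine ⟨Complex.ext rfl ?_, hf.1⟩
  exact (neg_eq_zero.1 hf.2.symm).symm

/-- The operator chosen in `sandwich` is the given one, by uniqueness. -/
theorem sandwich_eq [CompleteSpace H] {A : H →ₗ.[ℂ] H} (hA : Dense (A.domain : Set H))
    {B T : H →L[ℂ] H} (h : IsSandwich A B T) : sandwich A B = T := by
  have hex : ∃ T, IsSandwich A B T := ⟨T, h⟩
  rw [sandwich, dif_pos hex]
  exact hex.choose_spec.unique hA h

/-- An orthonormal family in a separable space is countable: balls of radius `1/2` around its
members are disjoint. -/
theorem _root_.Orthonormal.countable [TopologicalSpace.SeparableSpace H] {ι : Type*} {v : ι → H}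
    (hv : Orthonormal ℂ v) : Countable ι := by
  refine Pairwise.countable_of_isOpen_disjoint (s := fun i => Metric.ball (v i) (1 / 2)) ?_
    (fun i => Metric.isOpen_ball) (fun i => Metric.nonempty_ball.2 (by norm_num))
  intro i j hij
  refine Metric.ball_disjoint_ball ?_
  have h := norm_sub_sq (𝕜 := ℂ) (v i) (v j)
  rw [hv.1, hv.1, hv.2 hij, map_zero] at h
  rw [dist_eq_norm]
  nlinarith [norm_nonneg (v i - v j)]

/-- For operators of a definite sign the trace-class condition on `|T|` is the summability of the
diagonal of `T` itself. -/
theorem IsTraceClass.summable_of_nonneg [CompleteSpace H] {T : H →L[ℂ] H} (h : IsTraceClass T)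
    (hT : 0 ≤ T) : Summable fun i => (⟪basis H i, T (basis H i)⟫_ℂ).re := by
  simpa only [IsTraceClass, CFC.abs_of_nonneg T hT] using h

theorem IsTraceClass.summable_of_nonpos [CompleteSpace H] {T : H →L[ℂ] H} (h : IsTraceClass T)
    (hT : T ≤ 0) : Summable fun i => (⟪basis H i, T (basis H i)⟫_ℂ).re := by
  simp only [IsTraceClass, CFC.abs_of_nonpos T hT, neg_apply, inner_neg_right,
    Complex.neg_re] at h
  exact summable_neg_iff.1 h

end Hilbert

/-! ### The Fourier transform on `L¹ ∩ L²` -/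

/-- The inverse Fourier transform on `L²`, applied to an integrable function, is given by the
Fourier integral: both define the same tempered distribution, by Fubini's theorem. -/
theorem fourierInv_coeFn_ae_eq {E F : Type*} [NormedAddCommGroup E] [InnerProductSpace ℝ E]
    [FiniteDimensional ℝ E] [MeasurableSpace E] [BorelSpace E]
    [NormedAddCommGroup F] [InnerProductSpace ℂ F] [CompleteSpace F]
    (g : Lp (α := E) F 2) (hg : Integrable g) :
    ((Lp.fourierTransformₗᵢ E F).symm g : E → F) =ᵐ[volume] 𝓕⁻ (g : E → F) := by
  have hL : Continuous fun p : E × E => (-innerₗ E) p.1 p.2 := continuous_inner.neg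
  have hcont : Continuous (𝓕⁻ (g : E → F)) :=
    VectorFourier.fourierIntegral_continuous Real.continuous_fourierChar hL hg
  refine ae_eq_of_integral_contDiff_smul_eq ((Lp.memLp _).locallyIntegrable (by norm_num))
    hcont.locallyIntegrable fun φ hφ hφc => ?_
  have h1 : HasCompactSupport (Complex.ofRealCLM ∘ φ) := hφc.comp_left rfl
  have h2 := Complex.ofRealCLM.contDiff.comp hφ
  set ψ := h1.toSchwartzMap h2
  have hψ (x : E) : ψ x = (φ x : ℂ) := rfl
  have h3 := congrArg (fun D => D ψ) (Lp.fourierInv_toTemperedDistribution_eq g)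
  simp only [TemperedDistribution.fourierInv_apply, Lp.toTemperedDistribution_apply,
    hψ, SchwartzMap.fourierInv_coe] at h3
  have hs := VectorFourier.integral_fourierIntegral_smul_eq_flip (μ := (volume : Measure E))
    (ν := (volume : Measure E)) (L := -innerₗ E) Real.continuous_fourierChar hL
    ψ.integrable hg
  have hflip : (-innerₗ E).flip = -innerₗ E := by
    ext x y; simp [real_inner_comm]
  rw [hflip] at hs
  exact h3.symm.trans hs

/-! ### Cut-offs and bounded Fourier multipliers -/

section Cutoff

variable {X V : Type*} [MeasureSpace X] [NormedAddCommGroup V] [InnerProductSpace ℂ V]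

theorem mulIndicator_comp_self (S : Set X) (hS : MeasurableSet S)
    (f : Lp V 2 (volume : Measure X)) :
    mulIndicator S hS (mulIndicator S hS f) = mulIndicator S hS f := by
  refine Lp.ext ?_
  filter_upwards [coeFn_mulIndicator S hS (mulIndicator S hS f), coeFn_mulIndicator S hS f]
    with x h1 h2
  by_cases hx : x ∈ S <;> simp_all

theorem inner_mulIndicator_left (S : Set X) (hS : MeasurableSet S)
    (f g : Lp V 2 (volume : Measure X)) :
    ⟪mulIndicator S hS f, g⟫_ℂ = ⟪f, mulIndicator S hS g⟫_ℂ := by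
  rw [L2.inner_def, L2.inner_def]
  refine integral_congr_ae ?_
  filter_upwards [coeFn_mulIndicator S hS f, coeFn_mulIndicator S hS g] with x h1 h2
  by_cases hx : x ∈ S <;> simp_all

theorem mulIndicator_add_compl (S : Set X) (hS : MeasurableSet S)
    (f : Lp V 2 (volume : Measure X)) :
    mulIndicator S hS f + mulIndicator Sᶜ hS.compl f = f := by
  refine Lp.ext ?_
  filter_upwards [coeFn_mulIndicator S hS f, coeFn_mulIndicator Sᶜ hS.compl f,
    Lp.coeFn_add (mulIndicator S hS f) (mulIndicator Sᶜ hS.compl f)] with x h1 h2 h3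
  by_cases hx : x ∈ S <;> simp_all

theorem mulIndicator_compl_le_one [CompleteSpace V] (S : Set X) (hS : MeasurableSet S) :
    mulIndicator (V := V) Sᶜ hS.compl ≤ 1 := by
  set P := mulIndicator (V := V) S hS
  have h : 1 - mulIndicator (V := V) Sᶜ hS.compl = P.adjoint ∘L P := by
    refine ContinuousLinearMap.ext fun f => ext_inner_left ℂ fun g => ?_
    rw [ContinuousLinearMap.comp_apply, ContinuousLinearMap.adjoint_inner_right,
      inner_mulIndicator_left, mulIndicator_comp_self, sub_apply, one_apply_eq_self]
    exact congrArg _ (sub_eq_of_eq_add (mulIndicator_add_compl S hS f).symm)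
  rw [ContinuousLinearMap.le_def, h]
  exact ContinuousLinearMap.isPositive_adjoint_comp_self P

omit [InnerProductSpace ℂ V] in
theorem ofReal_norm_sq_eq_lintegral (f : Lp V 2 (volume : Measure X)) :
    ENNReal.ofReal (‖f‖ ^ 2) = ∫⁻ x, ‖f x‖ₑ ^ 2 := by
  rw [ENNReal.ofReal_pow (norm_nonneg _), ofReal_norm, Lp.enorm_def,
    eLpNorm_eq_lintegral_rpow_enorm_toReal (by norm_num) (by norm_num)]
  simp only [ENNReal.toReal_ofNat, ENNReal.rpow_ofNat]
  rw [← ENNReal.rpow_natCast, ← ENNReal.rpow_mul]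
  norm_num

theorem ofReal_norm_mulIndicator_sq (S : Set X) (hS : MeasurableSet S)
    (f : Lp V 2 (volume : Measure X)) :
    ENNReal.ofReal (‖mulIndicator S hS f‖ ^ 2) = ∫⁻ x in S, ‖f x‖ₑ ^ 2 := by
  rw [ofReal_norm_sq_eq_lintegral, ← lintegral_indicator hS]
  refine lintegral_congr_ae ?_
  filter_upwards [coeFn_mulIndicator S hS f] with x h1
  by_cases hx : x ∈ S <;> simp_all

/-- Multiplication by a bounded measurable real function, as a bounded operator on `L²(X, V)`. -/
def mulBounded (m : X → ℝ) (hm : Measurable m) (C : ℝ) (hC : ∀ x, |m x| ≤ C) :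
    Lp V 2 (volume : Measure X) →L[ℂ] Lp V 2 (volume : Measure X) :=
  have hbd (f : Lp V 2 (volume : Measure X)) : ∀ᵐ x, ‖(m x : ℂ) • f x‖ ≤ C * ‖f x‖ :=
    Filter.Eventually.of_forall fun x => by
      rw [norm_smul, Complex.norm_real]
      exact mul_le_mul_of_nonneg_right (hC x) (norm_nonneg _)
  have hdom (f : Lp V 2 (volume : Measure X)) : f ∈ (mulOperator (V := V) m).domain :=
    (Lp.memLp f).of_le_mul ((Complex.measurable_ofReal.comp hm).aestronglyMeasurable.smul
      (Lp.aestronglyMeasurable f)) (hbd f)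
  ((mulOperator (V := V) m).toFun ∘ₗ LinearMap.codRestrict _ LinearMap.id hdom).mkContinuous C
    fun f => by
      refine Lp.norm_le_mul_norm_of_ae_le_mul ?_
      filter_upwards [hbd f, MemLp.coeFn_toLp (hdom f)] with x h1 h2
      exact (congrArg norm h2).trans_le h1

theorem coeFn_mulBounded (m : X → ℝ) (hm : Measurable m) (C : ℝ) (hC : ∀ x, |m x| ≤ C)
    (f : Lp V 2 (volume : Measure X)) :
    mulBounded m hm C hC f =ᵐ[volume] fun x => (m x : ℂ) • f x :=
  MemLp.coeFn_toLp (LinearMap.codRestrict (mulOperator (V := V) m).domain LinearMap.id _ f).2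

theorem coeFn_mulOperator (m : X → ℝ) (f : (mulOperator (V := V) m).domain) :
    mulOperator m f =ᵐ[volume] fun x => (m x : ℂ) • (f : Lp V 2 (volume : Measure X)) x :=
  MemLp.coeFn_toLp f.2

end Cutoff

variable {d q : ℕ}

theorem measurableSet_symbol_nonpos (d : ℕ) (μ : ℝ) :
    MeasurableSet {ξ : Space d | symbol d μ ξ ≤ 0} :=
  (isClosed_le (continuous_symbol μ) continuous_const).measurableSet

theorem fourierL2_projMinus (μ : ℝ) (f : L2 d q) :
    fourierL2 d q (projMinus d q μ f) =
      mulIndicator _ (measurableSet_symbol_nonpos d μ) (fourierL2 d q f) :=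
  (fourierL2 d q).apply_symm_apply _

theorem projMinus_comp_self (μ : ℝ) (f : L2 d q) :
    projMinus d q μ (projMinus d q μ f) = projMinus d q μ f := by
  apply (fourierL2 d q).injective
  rw [fourierL2_projMinus, fourierL2_projMinus, mulIndicator_comp_self]

theorem inner_projMinus_left (μ : ℝ) (f g : L2 d q) :
    ⟪projMinus d q μ f, g⟫_ℂ = ⟪f, projMinus d q μ g⟫_ℂ := by
  rw [← (fourierL2 d q).inner_map_map, ← (fourierL2 d q).inner_map_map f,
    fourierL2_projMinus, fourierL2_projMinus, inner_mulIndicator_left]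

theorem coeFn_fourierL2_sqrtAbs (μ : ℝ) (f : (sqrtAbs d q μ).domain) :
    fourierL2 d q (sqrtAbs d q μ f) =ᵐ[volume]
      fun ξ => ((Real.sqrt |symbol d μ ξ| : ℝ) : ℂ) • fourierL2 d q f ξ := by
  have hf : fourierL2 d q f ∈ (mulOperator (V := EuclideanSpace ℂ (Fin q))
      fun ξ : Space d => Real.sqrt |symbol d μ ξ|).domain :=
    Submodule.mem_comap.1 f.2
  have h : fourierL2 d q (sqrtAbs d q μ f) = mulOperator _ ⟨fourierL2 d q f, hf⟩ :=
    (fourierL2 d q).apply_symm_apply _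
  rw [h]
  exact coeFn_mulOperator _ _

/-- The function `(-Δ - μ)₋^{1/2}` of the momentum, i.e. the square root of the negative part of
the symbol. -/
def sqrtNeg (d : ℕ) (μ : ℝ) (ξ : Space d) : ℝ := Real.sqrt (-symbol d μ ξ)

theorem continuous_sqrtNeg (μ : ℝ) : Continuous (sqrtNeg d μ) :=
  (continuous_symbol μ).neg.sqrt

theorem abs_sqrtNeg_le (μ : ℝ) (ξ : Space d) : |sqrtNeg d μ ξ| ≤ Real.sqrt μ := by
  rw [sqrtNeg, abs_of_nonneg (Real.sqrt_nonneg _)]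
  refine Real.sqrt_le_sqrt ?_
  rw [symbol]
  nlinarith [sq_nonneg (2 * Real.pi * ‖ξ‖)]

theorem sqrtNeg_sq (μ : ℝ) (ξ : Space d) : sqrtNeg d μ ξ ^ 2 = max (-symbol d μ ξ) 0 := by
  rw [sqrtNeg, Real.sq_sqrt']

/-- The bounded operator `(-Δ - μ)₋^{1/2} = |-Δ - μ|^{1/2} Π⁻` on `L²(ℝᵈ, ℂ^q)`. -/
def sqrtNegOp (d q : ℕ) (μ : ℝ) : L2 d q →L[ℂ] L2 d q :=
  ((fourierL2 d q).symm : L2 d q →L[ℂ] L2 d q) ∘L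
    mulBounded (sqrtNeg d μ) (continuous_sqrtNeg μ).measurable (Real.sqrt μ) (abs_sqrtNeg_le μ) ∘L
    (fourierL2 d q : L2 d q →L[ℂ] L2 d q)

theorem coeFn_fourierL2_sqrtNegOp (μ : ℝ) (f : L2 d q) :
    fourierL2 d q (sqrtNegOp d q μ f) =ᵐ[volume]
      fun ξ => (sqrtNeg d μ ξ : ℂ) • fourierL2 d q f ξ := by
  have h : fourierL2 d q (sqrtNegOp d q μ f) =
      mulBounded (sqrtNeg d μ) (continuous_sqrtNeg μ).measurable (Real.sqrt μ)
        (abs_sqrtNeg_le μ) (fourierL2 d q f) :=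
    (fourierL2 d q).apply_symm_apply _
  rw [h]
  exact coeFn_mulBounded _ _ _ _ _

/-- On its domain, `|-Δ - μ|^{1/2}` followed by `Π⁻` agrees with the bounded operator
`(-Δ - μ)₋^{1/2}`. -/
theorem projMinus_sqrtAbs (μ : ℝ) (f : (sqrtAbs d q μ).domain) :
    projMinus d q μ (sqrtAbs d q μ f) = sqrtNegOp d q μ f := by
  apply (fourierL2 d q).injective
  rw [fourierL2_projMinus]
  refine Lp.ext ?_
  filter_upwards [coeFn_mulIndicator _ (measurableSet_symbol_nonpos d μ)
    (fourierL2 d q (sqrtAbs d q μ f)), coeFn_fourierL2_sqrtAbs μ f,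
    coeFn_fourierL2_sqrtNegOp μ (f : L2 d q)] with ξ h1 h2 h3
  rw [h1, h3]
  by_cases hξ : ξ ∈ {ξ : Space d | symbol d μ ξ ≤ 0}
  · have hξ' : symbol d μ ξ ≤ 0 := hξ
    rw [Set.indicator_of_mem hξ, h2, abs_of_nonpos hξ', sqrtNeg]
  · have hξ' : 0 < symbol d μ ξ := not_le.1 hξ
    rw [Set.indicator_of_notMem hξ, sqrtNeg, Real.sqrt_eq_zero_of_nonpos (by linarith),
      Complex.ofReal_zero, zero_smul]

/-! ### The two blocks of the relative energy -/

/-- `|-Δ - μ|^{1/2} Q⁻⁻ |-Δ - μ|^{1/2}` is an explicit bounded operator, in which `Π⁻`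
has been replaced by `1` because the range of `(-Δ - μ)₋^{1/2}` is contained in that of `Π⁻`. -/
theorem isSandwich_blockMinus (μ : ℝ) (γ : L2 d q →L[ℂ] L2 d q) :
    IsSandwich (sqrtAbs d q μ) (blockMinus μ (γ - projMinus d q μ))
      ((sqrtNegOp d q μ).adjoint ∘L (γ - 1) ∘L sqrtNegOp d q μ) := by
  intro f g
  simp only [blockMinus, ContinuousLinearMap.comp_apply, sub_apply,
    ContinuousLinearMap.adjoint_inner_right, projMinus_comp_self, one_apply_eq_self]
  rw [← inner_projMinus_left, projMinus_sqrtAbs, projMinus_sqrtAbs]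

/-- Since `Π⁺ Π⁻ = 0`, the block `Q⁺⁺` of `Q = γ - Π⁻` is `Π⁺ γ Π⁺`. -/
theorem blockPlus_nonneg (μ : ℝ) {γ : L2 d q →L[ℂ] L2 d q} (hγ : 0 ≤ γ) :
    0 ≤ blockPlus μ (γ - projMinus d q μ) := by
  have hadj : (projPlus d q μ).adjoint = projPlus d q μ := by
    refine ContinuousLinearMap.ext fun f => ext_inner_right ℂ fun g => ?_
    rw [ContinuousLinearMap.adjoint_inner_left]
    simp only [projPlus, sub_apply, one_apply_eq_self, inner_sub_left, inner_sub_right,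
      inner_projMinus_left]
  have h : blockPlus μ (γ - projMinus d q μ) =
      (projPlus d q μ).adjoint ∘L γ ∘L projPlus d q μ := by
    rw [hadj]
    refine ContinuousLinearMap.ext fun f => ?_
    have h0 : projMinus d q μ (projPlus d q μ f) = 0 := by
      simp [projPlus, projMinus_comp_self]
    simp only [blockPlus, ContinuousLinearMap.comp_apply, sub_apply, h0, sub_zero]
  rw [h, ContinuousLinearMap.nonneg_iff_isPositive]
  exact ((ContinuousLinearMap.nonneg_iff_isPositive _).1 hγ).adjoint_conj _

/-! ### The Hilbert–Schmidt norm of `𝟙_S (-Δ - μ)₋^{1/2}` -/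

theorem enorm_sq_eq_sum (v : EuclideanSpace ℂ (Fin q)) : ‖v‖ₑ ^ 2 = ∑ j, ‖v j‖ₑ ^ 2 := by
  rw [← ofReal_norm, ← ENNReal.ofReal_pow (norm_nonneg _), EuclideanSpace.norm_sq_eq,
    ENNReal.ofReal_sum_of_nonneg fun _ _ => by positivity]
  refine Finset.sum_congr rfl fun j _ => ?_
  rw [ENNReal.ofReal_pow (norm_nonneg _), ofReal_norm]

theorem _root_.HilbertBasis.tsum_enorm_inner_sq {H ι : Type*} [NormedAddCommGroup H]
    [InnerProductSpace ℂ H] (b : HilbertBasis ι ℂ H) (y : H) :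
    ∑' i, ‖⟪y, b i⟫_ℂ‖ₑ ^ 2 = ENNReal.ofReal (‖y‖ ^ 2) := by
  have h : HasSum (fun i => ‖⟪y, b i⟫_ℂ‖ ^ 2) (‖y‖ ^ 2) := by
    have h1 := Complex.hasSum_re (b.hasSum_inner_mul_inner y y)
    have h2 : (⟪y, y⟫_ℂ).re = ‖y‖ ^ 2 := inner_self_eq_norm_sq (𝕜 := ℂ) y
    rw [h2] at h1
    convert! h1 using 2 with i
    rw [← inner_conj_symm (b i) y, Complex.mul_conj, Complex.ofReal_re, Complex.normSq_eq_norm_sq]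
  rw [← h.tsum_eq, ENNReal.ofReal_tsum_of_nonneg (fun _ => by positivity) h.summable]
  refine tsum_congr fun i => ?_
  rw [ENNReal.ofReal_pow (norm_nonneg _), ofReal_norm]

theorem memLp_sqrtNeg (μ : ℝ) : MemLp (sqrtNeg d μ) 2 := by
  refine (continuous_sqrtNeg μ).memLp_of_hasCompactSupport
    (HasCompactSupport.intro (isCompact_closedBall 0 (Real.sqrt μ / (2 * Real.pi))) fun ξ hξ => ?_)
  rw [mem_closedBall_zero_iff, not_le, div_lt_iff₀' (by positivity)] at hξ
  refine Real.sqrt_eq_zero_of_nonpos ?_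
  have := (Real.sqrt_lt_sqrt_iff_of_pos (x := μ) (y := (2 * Real.pi * ‖ξ‖) ^ 2)
    (by have := (Real.sqrt_nonneg μ).trans_lt hξ; positivity)).1
    (by rwa [Real.sqrt_sq (by positivity)])
  rw [symbol]
  linarith

theorem integrable_fourierL2_sqrtNegOp (μ : ℝ) (f : L2 d q) :
    Integrable (fourierL2 d q (sqrtNegOp d q μ f)) := by
  rw [← memLp_one_iff_integrable, memLp_congr_ae (coeFn_fourierL2_sqrtNegOp μ f)]
  have h : MemLp (fun ξ : Space d => (sqrtNeg d μ ξ : ℂ)) 2 := (memLp_sqrtNeg μ).ofReal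
  exact (Lp.memLp (fourierL2 d q f)).smul h

/-- The cut-off plane wave `ξ ↦ e^{-2πi ξ·x} (symbol ξ)₋^{1/2} eⱼ` in momentum space. Pairing with it
evaluates the `j`-th component of `(-Δ - μ)₋^{1/2} f` at `x`. -/
def planeWave (μ : ℝ) (x : Space d) (j : Fin q) (ξ : Space d) : EuclideanSpace ℂ (Fin q) :=
  Real.fourierChar (-⟪ξ, x⟫_ℝ) • (sqrtNeg d μ ξ : ℂ) • EuclideanSpace.single j (1 : ℂ)

theorem norm_planeWave (μ : ℝ) (x : Space d) (j : Fin q) (ξ : Space d) :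
    ‖planeWave μ x j ξ‖ = ‖sqrtNeg d μ ξ‖ := by
  rw [planeWave, Circle.norm_smul, norm_smul, PiLp.norm_single, norm_one, mul_one,
    Complex.norm_real]

theorem memLp_planeWave (μ : ℝ) (x : Space d) (j : Fin q) : MemLp (planeWave μ x j) 2 := by
  refine (memLp_sqrtNeg μ).of_le (Continuous.aestronglyMeasurable ?_)
    (Filter.Eventually.of_forall fun ξ => (norm_planeWave μ x j ξ).le)
  have h1 : Continuous fun ξ : Space d => Real.fourierChar (-⟪ξ, x⟫_ℝ) :=
    Real.continuous_fourierChar.comp (by fun_prop)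
  exact h1.smul ((Complex.continuous_ofReal.comp (continuous_sqrtNeg μ)).smul continuous_const)

theorem ofReal_norm_planeWave_sq (μ : ℝ) (x : Space d) (j : Fin q) :
    ENNReal.ofReal (‖(memLp_planeWave μ x j).toLp‖ ^ 2) =
      ENNReal.ofReal (∫ ξ : Space d, sqrtNeg d μ ξ ^ 2) := by
  rw [ofReal_norm_sq_eq_lintegral, ofReal_integral_eq_lintegral_ofReal
    (memLp_sqrtNeg μ).integrable_sq (Filter.Eventually.of_forall fun _ => sq_nonneg _)]
  refine lintegral_congr_ae ?_
  filter_upwards [(memLp_planeWave μ x j).coeFn_toLp] with ξ h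
  rw [h, ← ofReal_norm, norm_planeWave, ← ENNReal.ofReal_pow (norm_nonneg _), Real.norm_eq_abs,
    sq_abs]

/-- Almost every value of `(-Δ - μ)₋^{1/2} f` is a pairing of `𝓕f` with cut-off plane waves: the
Fourier transform of `(-Δ - μ)₋^{1/2} f` is a product of two square-integrable functions, hence
integrable, so that it can be inverted pointwise. -/
theorem sqrtNegOp_apply_ae_eq (μ : ℝ) (f : L2 d q) :
    ∀ᵐ x, ∀ j, sqrtNegOp d q μ f x j = ⟪(memLp_planeWave μ x j).toLp, fourierL2 d q f⟫_ℂ := by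
  have hu := integrable_fourierL2_sqrtNegOp μ f
  have h1 := fourierInv_coeFn_ae_eq (fourierL2 d q (sqrtNegOp d q μ f)) hu
  have h0 : (Lp.fourierTransformₗᵢ (Space d) (EuclideanSpace ℂ (Fin q))).symm
    (fourierL2 d q (sqrtNegOp d q μ f)) = sqrtNegOp d q μ f :=
    (fourierL2 d q).symm_apply_apply _
  rw [h0] at h1
  filter_upwards [h1] with x hx j
  have hint : Integrable fun ξ => Real.fourierChar ⟪ξ, x⟫_ℝ • fourierL2 d q (sqrtNegOp d q μ f) ξ :=
    hu.mono (((Real.continuous_fourierChar.comp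
      (by fun_prop : Continuous fun ξ : Space d => ⟪ξ, x⟫_ℝ)).aestronglyMeasurable).smul hu.1)
      (Filter.Eventually.of_forall fun ξ => (Circle.norm_smul _ _).le)
  have h2 (v : EuclideanSpace ℂ (Fin q)) : v j = ⟪EuclideanSpace.single j (1 : ℂ), v⟫_ℂ := by
    simp [EuclideanSpace.inner_single_left]
  rw [hx, Real.fourierInv_eq, h2, ← integral_inner hint, L2.inner_def]
  refine integral_congr_ae ?_
  filter_upwards [coeFn_fourierL2_sqrtNegOp μ f, (memLp_planeWave μ x j).coeFn_toLp] with ξ h3 h4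
  rw [h3, h4, planeWave, Circle.smul_def, Circle.smul_def, inner_smul_left, inner_smul_left,
    inner_smul_right, inner_smul_right, AddChar.map_neg_eq_inv, Circle.coe_inv_eq_conj,
    Complex.conj_conj, Complex.conj_ofReal]

/-- The Hilbert–Schmidt norm of `𝟙_S (-Δ - μ)₋^{1/2}`: by Tonelli and Parseval it is the integral
over `x ∈ S` of the squared norms of the cut-off plane waves, which do not depend on `x`. -/
theorem tsum_norm_mulIndicator_sqrtNegOp_sq {ι : Type*} [Countable ι]
    (b : HilbertBasis ι ℂ (L2 d q)) (μ : ℝ) (S : Set (Space d)) (hS : MeasurableSet S) :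
    ∑' i, ENNReal.ofReal (‖mulIndicator S hS (sqrtNegOp d q μ (b i))‖ ^ 2) =
      q * ENNReal.ofReal (∫ ξ : Space d, sqrtNeg d μ ξ ^ 2) * volume S := by
  simp_rw [ofReal_norm_mulIndicator_sq]
  rw [← lintegral_tsum fun i => ((Lp.aestronglyMeasurable _).enorm.pow_const 2).restrict,
    ← setLIntegral_const]
  refine lintegral_congr_ae (ae_restrict_of_ae ?_)
  filter_upwards [ae_all_iff.2 fun i => sqrtNegOp_apply_ae_eq μ (b i)] with x hx
  have hj (j : Fin q) : ∑' i, ‖sqrtNegOp d q μ (b i) x j‖ₑ ^ 2 =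
      ENNReal.ofReal (∫ ξ : Space d, sqrtNeg d μ ξ ^ 2) := by
    rw [← ofReal_norm_planeWave_sq μ x j, ← (fourierL2 d q).symm.norm_map,
      ← b.tsum_enorm_inner_sq]
    refine tsum_congr fun i => ?_
    rw [hx i j, ← (fourierL2 d q).inner_map_map _ (b i), LinearIsometryEquiv.apply_symm_apply]
  simp_rw [enorm_sq_eq_sum]
  rw [Summable.tsum_finsetSum fun _ _ => ENNReal.summable]
  simp_rw [hj]
  simp

/-! ### The semiclassical constant -/

theorem fermiDensity_eq (hd : 1 ≤ d) (μ : ℝ) :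
    fermiDensity d q μ = q * (Real.sqrt μ / (2 * Real.pi)) ^ d *
      (volume : Measure (Space d)).real (Metric.ball 0 1) := by
  have : Nonempty (Fin d) := ⟨⟨0, hd⟩⟩
  have h : {p : Space d | ‖p‖ ^ 2 < μ} = Metric.ball 0 (Real.sqrt μ) := by
    ext p
    rw [mem_ball_zero_iff, Real.lt_sqrt (norm_nonneg _)]
    rfl
  rw [fermiDensity, h, measureReal_def, Measure.addHaar_ball _ _ (Real.sqrt_nonneg _),
    ENNReal.toReal_mul, ENNReal.toReal_ofReal (by positivity), ← measureReal_def,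
    finrank_euclideanSpace_fin, div_pow]
  ring

/-- The integral of the negative part of the symbol, in polar coordinates: it is supported in the
ball of radius `√μ / 2π`. -/
theorem integral_sqrtNeg_sq (hd : 1 ≤ d) {μ : ℝ} (hμ : 0 ≤ μ) :
    ∫ ξ : Space d, sqrtNeg d μ ξ ^ 2 = 2 / (d + 2) * μ * (Real.sqrt μ / (2 * Real.pi)) ^ d *
      (volume : Measure (Space d)).real (Metric.ball 0 1) := by
  have : Nonempty (Fin d) := ⟨⟨0, hd⟩⟩
  obtain ⟨n, rfl⟩ : ∃ n, d = n + 1 := ⟨d - 1, by omega⟩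
  set R := Real.sqrt μ / (2 * Real.pi) with hR
  have hR0 : 0 ≤ R := by positivity
  have hRμ : (2 * Real.pi * R) ^ 2 = μ := by
    rw [hR, mul_div_cancel₀ _ (by positivity), Real.sq_sqrt hμ]
  have h1 := integral_fun_norm_addHaar (volume : Measure (Space (n + 1)))
    fun r => max (μ - (2 * Real.pi * r) ^ 2) 0
  have h2 : ∫ r in Set.Ioi (0 : ℝ), r ^ n • max (μ - (2 * Real.pi * r) ^ 2) 0 =
      ∫ r in (0 : ℝ)..R, (μ * r ^ n - (2 * Real.pi) ^ 2 * r ^ (n + 2)) := by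
    rw [intervalIntegral.integral_of_le hR0]
    refine setIntegral_eq_of_subset_of_forall_sdiff_eq_zero measurableSet_Ioi
      Set.Ioc_subset_Ioi_self ?_ |>.trans (setIntegral_congr_fun measurableSet_Ioc ?_)
    · rintro r ⟨hr, hr'⟩
      have hr0 : 0 < r := hr
      have hrR : R < r := by
        by_contra h
        exact hr' ⟨hr0, not_lt.1 h⟩
      have : (2 * Real.pi * R) ^ 2 ≤ (2 * Real.pi * r) ^ 2 := by gcongr
      rw [max_eq_right (by linarith), smul_zero]
    · rintro r ⟨hr, hr'⟩
      have : (2 * Real.pi * r) ^ 2 ≤ (2 * Real.pi * R) ^ 2 := by gcongr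
      simp only [smul_eq_mul]
      rw [max_eq_left (by linarith)]
      ring
  simp only [finrank_euclideanSpace_fin, Nat.add_sub_cancel] at h1
  rw [h2, intervalIntegral.integral_sub
      (Continuous.intervalIntegrable (by fun_prop) _ _)
      (Continuous.intervalIntegrable (by fun_prop) _ _),
    intervalIntegral.integral_const_mul, intervalIntegral.integral_const_mul, integral_pow,
    integral_pow] at h1
  simp only [sqrtNeg_sq, symbol, neg_sub]
  rw [h1, nsmul_eq_mul, smul_eq_mul, ← hRμ]
  push_cast
  simp only [ne_eq, Nat.succ_ne_zero, not_false_eq_true, zero_pow, sub_zero]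
  field_simp
  ring

/-- The semiclassical constant is exactly the energy density of the filled Fermi sea; both sides
vanish if `μ = 0`. -/
theorem semiclassical_eq (hd : 1 ≤ d) (hq : 1 ≤ q) {μ : ℝ} (hμ : 0 ≤ μ) :
    2 / (d : ℝ) * Ksc d q * fermiDensity d q μ ^ (1 + 2 / (d : ℝ)) =
      q * ∫ ξ : Space d, sqrtNeg d μ ξ ^ 2 := by
  have hd0 : (0 : ℝ) < d := by exact_mod_cast hd
  have hq0 : (0 : ℝ) < q := by exact_mod_cast hq
  have hv : 0 < (volume : Measure (Space d)).real (Metric.ball 0 1) :=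
    ENNReal.toReal_pos (Metric.measure_ball_pos _ _ one_pos).ne' measure_ball_lt_top.ne
  have hs : sphereArea d = d * (volume : Measure (Space d)).real (Metric.ball 0 1) := by
    rw [sphereArea, Measure.toSphere_real_apply_univ, finrank_euclideanSpace_fin]
  rw [integral_sqrtNeg_sq hd hμ, fermiDensity_eq hd μ, Ksc, hs]
  set v := (volume : Measure (Space d)).real (Metric.ball 0 1)
  set ρ := q * (Real.sqrt μ / (2 * Real.pi)) ^ d * v with hρ
  have hρ0 : 0 ≤ ρ := by positivity
  have h1 : ρ ^ (1 + 2 / (d : ℝ)) = ρ * ρ ^ (2 / (d : ℝ)) := by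
    rw [Real.rpow_add' hρ0 (by positivity), Real.rpow_one]
  have h2 : (d * (2 * Real.pi) ^ d / (q * (d * v))) ^ (2 / (d : ℝ)) * ρ ^ (2 / (d : ℝ)) = μ := by
    rw [← Real.mul_rpow (by positivity) hρ0]
    have : d * (2 * Real.pi) ^ d / (q * (d * v)) * ρ = Real.sqrt μ ^ d := by
      rw [hρ, div_pow]; field_simp
    rw [this, ← Real.rpow_natCast, ← Real.rpow_mul (Real.sqrt_nonneg _),
      mul_div_cancel₀ _ hd0.ne', Real.rpow_two, Real.sq_sqrt hμ]
  calc _ = 2 / (d + 2) * ρ * ((d * (2 * Real.pi) ^ d / (q * (d * v))) ^ (2 / (d : ℝ)) *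
        ρ ^ (2 / (d : ℝ))) := by rw [h1]; field_simp
    _ = _ := by rw [h2, hρ]; ring

end FermiSea

end

/-! ### The lower bound on the relative energy -/

open FermiSea in
theorem theorem6 (d q : ℕ) (hd : 1 ≤ d) (hq : 1 ≤ q) (μ : ℝ) (hμ : 0 ≤ μ)
    (Ω : Set (EuclideanSpace ℝ (Fin d))) (hΩ : IsOpen Ω) (hΩfin : volume Ω ≠ ⊤)
    (γ : L2 d q →L[ℂ] L2 d q) (hγ0 : 0 ≤ γ)
    (hγ1 : γ ≤ mulIndicator Ωᶜ hΩ.measurableSet.compl)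
    (hQ : HasFiniteRelativeEnergy μ (γ - projMinus d q μ)) :
    2 / (d : ℝ) * Ksc d q * fermiDensity d q μ ^ (1 + 2 / (d : ℝ)) * volume.real Ω
      ≤ relativeEnergy μ (γ - projMinus d q μ) := by
  obtain ⟨⟨T, hT, hTtr⟩, ⟨T', hT', hTtr'⟩⟩ := hQ
  have hdense := dense_domain_sqrtAbs (d := d) (q := q) μ
  set M := sqrtNegOp d q μ
  set P := mulIndicator (V := EuclideanSpace ℂ (Fin q)) Ω hΩ.measurableSet
  have hT'M : T' = M.adjoint ∘L (γ - 1) ∘L M := hT'.unique hdense (isSandwich_blockMinus μ γ)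
  have hT0 : 0 ≤ T := hT.nonneg hdense (blockPlus_nonneg μ hγ0)
  -- `1 - γ ≥ 𝟙_Ω`, conjugated by `M`.
  have hlow (f : L2 d q) : ‖P (M f)‖ ^ 2 ≤ -(⟪f, T' f⟫_ℂ).re := by
    have h1 := (ContinuousLinearMap.le_def _ _).1 hγ1 |>.re_inner_nonneg_right (M f)
    have h2 : mulIndicator Ωᶜ hΩ.measurableSet.compl (M f) = M f - P (M f) :=
      eq_sub_of_add_eq' (mulIndicator_add_compl Ω hΩ.measurableSet (M f))
    have h3 : (⟪M f, P (M f)⟫_ℂ).re = ‖P (M f)‖ ^ 2 := by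
      have h4 := inner_mulIndicator_left Ω hΩ.measurableSet (M f) (P (M f))
      rw [mulIndicator_comp_self] at h4
      rw [← h4]
      exact inner_self_eq_norm_sq (𝕜 := ℂ) (P (M f))
    rw [hT'M, ContinuousLinearMap.comp_apply, ContinuousLinearMap.adjoint_inner_right]
    simp only [ContinuousLinearMap.comp_apply, sub_apply, one_apply_eq_self, inner_sub_right,
      h2, RCLike.re_eq_complex_re, Complex.sub_re, h3] at h1 ⊢
    linarith
  have hT'0 : T' ≤ 0 := by
    have hγ : γ ≤ 1 := hγ1.trans (mulIndicator_compl_le_one Ω hΩ.measurableSet)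
    have h := ((ContinuousLinearMap.le_def _ _).1 hγ).adjoint_conj M
    rw [ContinuousLinearMap.le_def]
    convert! h using 1
    rw [hT'M]
    ext1 f
    simp
  have hs := hTtr.summable_of_nonneg hT0
  have hs' := hTtr'.summable_of_nonpos hT'0
  have hE : relativeEnergy μ (γ - projMinus d q μ) =
      ∑' i, (⟪basis (L2 d q) i, T (basis _ i)⟫_ℂ).re -
        ∑' i, (⟪basis (L2 d q) i, T' (basis _ i)⟫_ℂ).re := by
    -- The diagonal of a symmetric operator is real, so the complex series is a real one.
    have hsymm := ((ContinuousLinearMap.le_def _ _).1 (hT'0.trans hT0)).isSymmetric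
    rw [relativeEnergy, sandwich_eq hdense (hT.sub hT'), trace, ← hs.tsum_sub hs',
      ← Complex.ofReal_re (∑' i, _), Complex.ofReal_tsum]
    refine congrArg Complex.re (tsum_congr fun i => ?_)
    rw [← Complex.sub_re, ← inner_sub_right]
    exact (hsymm.coe_re_inner_self_apply _).symm
  have : Fact ((2 : ℝ≥0∞) ≠ ⊤) := ⟨ENNReal.ofNat_ne_top⟩
  have : Countable (basisIndex (L2 d q)) := (basis (L2 d q)).orthonormal.countable
  have hsM : Summable fun i => ‖P (M (basis (L2 d q) i))‖ ^ 2 :=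
    hs'.neg.of_nonneg_of_le (fun _ => sq_nonneg _) fun i => hlow _
  have hHS : ∑' i, ‖P (M (basis (L2 d q) i))‖ ^ 2 =
      q * (∫ ξ : Space d, sqrtNeg d μ ξ ^ 2) * volume.real Ω := by
    have h := tsum_norm_mulIndicator_sqrtNegOp_sq (basis (L2 d q)) μ Ω hΩ.measurableSet
    rw [← ENNReal.ofReal_tsum_of_nonneg (fun _ => sq_nonneg _) hsM] at h
    have h' := congrArg ENNReal.toReal h
    rwa [ENNReal.toReal_ofReal (tsum_nonneg fun _ => sq_nonneg _), ENNReal.toReal_mul,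
      ENNReal.toReal_mul, ENNReal.toReal_natCast,
      ENNReal.toReal_ofReal (integral_nonneg fun _ => sq_nonneg _)] at h'
  have hpos : 0 ≤ ∑' i, (⟪basis (L2 d q) i, T (basis _ i)⟫_ℂ).re := tsum_nonneg fun i =>
    ((ContinuousLinearMap.nonneg_iff_isPositive _).1 hT0).re_inner_nonneg_right _
  have hle := hsM.tsum_le_tsum (fun i => hlow _) hs'.neg
  rw [semiclassical_eq hd hq hμ, ← hHS, hE]
  rw [tsum_neg] at hle
  linarith
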